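/- Let $d\ge 2$ be an integer and $c\in(0,1]$. Let $\overrightarrow{\mathbb T}_d$ be the homogeneous tree in which every vertex has $d+1$ neighbours, with a distinguished root and all edges directed away from the root (so the root has $d+1$ children and every other vertex has $d$ children). For $q>0$ with $dq<1$, consider the following frog model on $\overrightarrow{\mathbb T}_d$. There is one particle at each vertex; at time $0$ the particle at the root is active and all others are inactive. Each vertex $v$ carries a lifetime $\mathcal T_v$ with values in $\{0,1,2,\dots\}$ and $\mathbb P(\mathcal T_v\ge n)=c(dq)^n$ for all $n\ge1$, and a discrete-time random walk from $v$ that at each step jumps to a uniformly chosen child of its current vertex; all lifetimes and walks are independent. Once activated, the particle of $v$ performs the first $\mathcal T_v$ jumps of its walk, one per unit of time, and is then removed; an inactive particle is activated when an active particle visits its vertex. The model survives if at every time there is at least one active particle. Let $\theta(d,c,q)$ be the probability of survival and $$q_c(d)=q_c(d,c):=\inf\{q>0:\ dq<1,\ \theta(d,c,q)>0\}.$$ Then, for every $d\ge 2$ and $c\in(0,1]$, $$\frac{1}{d(c+1)-\left(\frac{c}{c+1}\right)^2}\le q_c(d),$$ and, for every $d\ge3$ and $c\in(0,1]$, $$q_c(d)\le\frac{F(c,d)-\sqrt{F(c,d)^2-224\,c^2(c+1)^2}}{16\,c^2},\qquad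 F(c,d):=7d(c+1)^3-8c^2 .$$ -/

import Mathlib

open MeasureTheory ProbabilityTheory

namespace FrogTree

/-- Vertices of the homogeneous tree in which every vertex has `d + 1` neighbours, rooted at
`root`. The root has the `d + 1` children `node i []`, and `node i l` has the `d` children
`node i (j :: l)`. Directing the edges away from the root, they go from a vertex to its
children. -/
inductive Vertex (d : ℕ) : Type
  | root : Vertex d
  | node (i : Fin (d + 1)) (l : List (Fin d)) : Vertex d

/-- The distance from a vertex to the root. -/
def Vertex.level {d : ℕ} : Vertex d → ℕ
  | .root => 0
  | .node _ l => l.length + 1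

/-- The randomness of one step of a walk: a child number to be used at the root, and a child number
to be used at the other vertices. -/
abbrev Step (d : ℕ) : Type := Fin (d + 1) × Fin d

/-- One step along a directed edge, to the child selected by `x`. -/
def Vertex.child {d : ℕ} : Vertex d → Step d → Vertex d
  | .root, x => .node x.1 []
  | .node i l, x => .node i (x.2 :: l)

/-- The walk on the directed tree that starts from `v` and uses the steps `ξ 0, ξ 1, …`. -/
def walk {d : ℕ} (v : Vertex d) (ξ : ℕ → Step d) : ℕ → Vertex d
  | 0 => v
  | n + 1 => (walk v ξ n).child (ξ n)

/-- The randomness of one particle: its lifetime (the number of jumps that it makes once it is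
active) and the steps of its walk. -/
abbrev Particle (d : ℕ) : Type := ℕ × (ℕ → Step d)

/-- A realization of the model: one particle at every vertex. -/
abbrev Config (d : ℕ) : Type := Vertex d → Particle d

/-- `ActivatedAt ω v t`: in the realization `ω`, the particle of `v` is activated at time `t`.
The particle of the root is active from time `0`; a particle activated at time `s` at `u`, with
lifetime `T`, is at the `n`-th vertex of its walk at time `s + n` for `n ≤ T`, and activates
the particle that sits there. Every jump leads away from the root, so the time is unique
(`ActivatedAt.eq_level`). -/
inductive ActivatedAt {d : ℕ} (ω : Config d) : Vertex d → ℕ → Prop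
  | root : ActivatedAt ω .root 0
  | visit {u : Vertex d} {s n : ℕ} (hu : ActivatedAt ω u s) (hn : n ≤ (ω u).1) :
      ActivatedAt ω (walk u (ω u).2 n) (s + n)

theorem level_walk {d : ℕ} (v : Vertex d) (ξ : ℕ → Step d) (n : ℕ) :
    (walk v ξ n).level = v.level + n := by
  induction n with
  | zero => rfl
  | succ n ih =>
    have h : ∀ (w : Vertex d) (x : Step d), (w.child x).level = w.level + 1 := by
      rintro (_ | _) x <;> simp [Vertex.child, Vertex.level]
    rw [walk, h, ih]; rfl

theorem ActivatedAt.eq_level {d : ℕ} {ω : Config d} {v : Vertex d} {t : ℕ}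
    (h : ActivatedAt ω v t) : t = v.level := by
  induction h with
  | root => rfl
  | visit hu hn ih => rw [level_walk, ih]

/-- Survival: at every time `t` there is an active particle, that is, a particle which has been
activated at a time `s ≤ t` and which is not removed before time `t`. -/
def Survives {d : ℕ} (ω : Config d) : Prop :=
  ∀ t : ℕ, ∃ (v : Vertex d) (s : ℕ), ActivatedAt ω v s ∧ s ≤ t ∧ t ≤ s + (ω v).1

/-- The parameters for which the model makes sense: `d ≥ 2`, `c ∈ (0, 1]`, `q > 0`, and
`d q < 1`, so that `n ↦ c (d q) ^ n`, `n ≥ 1`, is the tail of a random variable with values in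
`ℕ`. -/
structure Admissible (d : ℕ) (c q : ℝ) : Prop where
  two_le : 2 ≤ d
  c_pos : 0 < c
  c_le_one : c ≤ 1
  q_pos : 0 < q
  dq_lt_one : d * q < 1

/-- The prescribed tail `P(T ≥ n)` of the lifetime `T`. -/
noncomputable def tail (d : ℕ) (c q : ℝ) (n : ℕ) : ℝ :=
  if n = 0 then 1 else c * (d * q) ^ n

theorem Admissible.dq_pos {d : ℕ} {c q : ℝ} (h : Admissible d c q) : 0 < d * q := by
  have := h.two_le
  have := h.q_pos
  positivity

theorem Admissible.tail_anti {d : ℕ} {c q : ℝ} (h : Admissible d c q) (n : ℕ) :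
    0 ≤ tail d c q n - tail d c q (n + 1) := by
  have h0 := h.dq_pos
  have h1 := h.dq_lt_one
  have hc := h.c_pos
  have hc1 := h.c_le_one
  rcases Nat.eq_zero_or_pos n with rfl | hn
  · simp only [tail, if_true, Nat.zero_add, one_ne_zero, if_false, pow_one]
    nlinarith
  · simp only [tail, hn.ne', if_false, Nat.succ_ne_zero]
    have : 0 < (d * q) ^ n := by positivity
    rw [pow_succ]
    nlinarith [mul_pos hc this]

theorem Admissible.hasSum_tail {d : ℕ} {c q : ℝ} (h : Admissible d c q) (m : ℕ) :
    HasSum (fun n => tail d c q (n + m) - tail d c q (n + m + 1)) (tail d c q m) := by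
  rw [hasSum_iff_tendsto_nat_of_nonneg (fun n => h.tail_anti (n + m))]
  have hs : ∀ N : ℕ, ∑ n ∈ Finset.range N, (tail d c q (n + m) - tail d c q (n + m + 1))
      = tail d c q m - tail d c q (N + m) := by
    intro N
    induction N with
    | zero => simp
    | succ N ih => rw [Finset.sum_range_succ, ih, Nat.add_right_comm N 1 m]; ring
  simp only [hs]
  have ht : Filter.Tendsto (tail d c q) Filter.atTop (nhds 0) := by
    have := (tendsto_pow_atTop_nhds_zero_of_lt_one h.dq_pos.le h.dq_lt_one).const_mul c
    rw [mul_zero] at this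
    refine this.congr' ?_
    filter_upwards [Filter.eventually_gt_atTop 0] with n hn
    simp [tail, hn.ne']
  simpa using ((Filter.tendsto_add_atTop_iff_nat m).2 ht).const_sub (tail d c q m)

/-- The law of the lifetime `T`, given by `P(T = n) = P(T ≥ n) - P(T ≥ n + 1)`. -/
noncomputable def lifetime {d : ℕ} {c q : ℝ} (h : Admissible d c q) : PMF ℕ :=
  ⟨fun n => ENNReal.ofReal (tail d c q n - tail d c q (n + 1)), by
    have h1 := (h.hasSum_tail 0)
    have h2 : tail d c q 0 = 1 := by simp [tail]
    rw [h2] at h1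
    have h3 := ENNReal.ofReal_tsum_of_nonneg (fun n => h.tail_anti n) h1.summable
    rw [show ∑' n, (tail d c q n - tail d c q (n + 1)) = 1 from h1.tsum_eq,
      ENNReal.ofReal_one] at h3
    exact h3 ▸ ENNReal.summable.hasSum⟩

/-- The lifetime has the tail `P(T ≥ n) = c (d q) ^ n`, `n ≥ 1`. -/
theorem lifetime_tail {d : ℕ} {c q : ℝ} (h : Admissible d c q) (n : ℕ) (hn : 1 ≤ n) :
    (lifetime h).toMeasure {k | n ≤ k} = ENNReal.ofReal (c * (d * q) ^ n) := by
  have hT : tail d c q n = c * (d * q) ^ n := by simp [tail, (show n ≠ 0 by omega)]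
  have h1 := h.hasSum_tail n
  rw [← hT, ← h1.tsum_eq, ENNReal.ofReal_tsum_of_nonneg (fun k => h.tail_anti (k + n)) h1.summable,
    PMF.toMeasure_apply _ (MeasurableSet.of_discrete)]
  have hr : Set.range (fun k => k + n) = {k | n ≤ k} := by
    ext k
    constructor
    · rintro ⟨j, rfl⟩
      simp
    · intro hk
      exact ⟨k - n, Nat.sub_add_cancel hk⟩
  rw [← hr, ← tsum_subtype, tsum_range (g := fun k => k + n) (f := fun k => lifetime h k)
    (add_left_injective n)]
  rfl

/-- The law of one step: uniform, so that a walk jumps to each child of its current vertex with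
the same probability. -/
noncomputable def stepLaw (d : ℕ) : Measure (Step d) := uniformOn Set.univ

theorem Admissible.isProbabilityMeasure_stepLaw {d : ℕ} {c q : ℝ} (h : Admissible d c q) :
    IsProbabilityMeasure (stepLaw d) := by
  have : NeZero d := ⟨by have := h.two_le; omega⟩
  exact isProbabilityMeasure_uniformOn Set.finite_univ Set.univ_nonempty

/-- The law of one particle: its lifetime and the steps of its walk are all independent. -/
noncomputable def particleLaw {d : ℕ} {c q : ℝ} (h : Admissible d c q) : Measure (Particle d) :=
  haveI := h.isProbabilityMeasure_stepLaw
  (lifetime h).toMeasure.prod (Measure.infinitePi fun _ : ℕ => stepLaw d)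

instance {d : ℕ} {c q : ℝ} (h : Admissible d c q) : IsProbabilityMeasure (particleLaw h) := by
  have := h.isProbabilityMeasure_stepLaw
  unfold particleLaw
  infer_instance

/-- The law of the model: the particles at the different vertices are independent. -/
noncomputable def frogLaw {d : ℕ} {c q : ℝ} (h : Admissible d c q) : Measure (Config d) :=
  Measure.infinitePi fun _ : Vertex d => particleLaw h

/-- The probability of survival `θ(d, c, q)`. -/
noncomputable def survivalProb {d : ℕ} {c q : ℝ} (h : Admissible d c q) : ℝ :=
  (frogLaw h).real {ω | Survives ω}

/-- The critical parameter `q_c(d, c) = inf {q > 0 : θ(d, c, q) > 0}`. -/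
noncomputable def criticalQ (d : ℕ) (c : ℝ) : ℝ :=
  sInf {q : ℝ | ∃ h : Admissible d c q, 0 < survivalProb h}

/-- The expression `F(c, d) = 7 d (c + 1)³ - 8 c²`. -/
noncomputable def F (c : ℝ) (d : ℕ) : ℝ := 7 * d * (c + 1) ^ 3 - 8 * c ^ 2

end FrogTree

/-!
A particle other than that of the root is activated exactly when some activated strict ancestor
visits its vertex, and the closest ancestor that visits it is then activated too. This makes the
activation of the `n`-th vertex of a ray a renewal event, whose step `k + 1` has weight
`c q ^ (k + 1)` times the probability that none of the `k` intermediate particles visits. Multiplied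
by `d ^ (k + 1)`, these weights sum to the mean offspring. If it is below one, the expected number
of activated vertices at level `n` tends to zero. If it exceeds one, some block length `m` has
`d ^ m` times the renewal probability at `m` above one, and a weighted second moment bound for the
block branching process gives survival. It remains to bound the mean: with `y = d q (c + 1)` and
`s = c / (c + 1)`, the upper estimate on the critical parameter becomes
`7 y ^ 2 < 8 (1 + q) (1 - (1 - s) y q)` at the smaller root `q`.
-/

namespace FrogTree

section Renewal

variable {u : ℕ → ℝ}

/-- The renewal sequence of the weights `u`, with `u k` the weight of the step `k + 1`: the sum,
over all compositions of `n`, of the products of the weights of the parts. -/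
def renewal (u : ℕ → ℝ) : ℕ → ℝ
  | 0 => 1
  | n + 1 => ∑ k : Fin (n + 1), u k * renewal u (n - k)

@[simp]
theorem renewal_zero : renewal u 0 = 1 := by rw [renewal]

theorem renewal_succ (u : ℕ → ℝ) (n : ℕ) :
    renewal u (n + 1) = ∑ k ∈ Finset.range (n + 1), u k * renewal u (n - k) := by
  rw [renewal, Finset.sum_range fun k => u k * renewal u (n - k)]

theorem renewal_nonneg (hu : ∀ k, 0 ≤ u k) (n : ℕ) : 0 ≤ renewal u n := by
  induction n using Nat.strong_induction_on with
  | _ n ih =>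
    rcases n with _ | n
    · simp
    · rw [renewal_succ]
      exact Finset.sum_nonneg fun k _ => mul_nonneg (hu k) (ih _ (by lia))

theorem renewal_pow_mul (x : ℝ) (u : ℕ → ℝ) (n : ℕ) :
    renewal (fun k => x ^ (k + 1) * u k) n = x ^ n * renewal u n := by
  induction n using Nat.strong_induction_on with
  | _ n ih =>
    rcases n with _ | n
    · simp
    · rw [renewal_succ, renewal_succ, Finset.mul_sum]
      refine Finset.sum_congr rfl fun k hk => ?_
      have hkn : k ≤ n := Finset.mem_range_succ_iff.1 hk
      rw [ih _ (by lia), show n + 1 = (k + 1) + (n - k) by lia, pow_add]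
      ring

theorem sum_range_succ_renewal (u : ℕ → ℝ) (N : ℕ) :
    ∑ n ∈ Finset.range (N + 1), renewal u n =
      1 + ∑ k ∈ Finset.range N, u k * ∑ i ∈ Finset.range (N - k), renewal u i := by
  rw [Finset.sum_range_succ', renewal_zero, add_comm]
  simp only [renewal_succ, Finset.mul_sum]
  rw [Finset.sum_range_diag_flip N fun k i => u k * renewal u i]

theorem summable_renewal (hu : ∀ k, 0 ≤ u k) (hs : Summable u) (h : ∑' k, u k < 1) :
    Summable (renewal u) := by
  have ha := renewal_nonneg hu
  refine summable_of_sum_range_le (c := 1 / (1 - ∑' k, u k)) ha fun N => ?_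
  set S := ∑ n ∈ Finset.range N, renewal u n with hS
  have hS0 : 0 ≤ S := Finset.sum_nonneg fun n _ => ha n
  have hconv : ∑ k ∈ Finset.range N, u k * ∑ i ∈ Finset.range (N - k), renewal u i
      ≤ (∑' k, u k) * S :=
    calc ∑ k ∈ Finset.range N, u k * ∑ i ∈ Finset.range (N - k), renewal u i
        ≤ ∑ k ∈ Finset.range N, u k * S := by
          gcongr with k
          · exact hu k
          · exact Finset.sum_le_sum_of_subset_of_nonneg (Finset.range_mono (by lia))
              fun n _ _ => ha n
      _ = (∑ k ∈ Finset.range N, u k) * S := by rw [Finset.sum_mul]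
      _ ≤ (∑' k, u k) * S := by
          gcongr
          exact hs.sum_le_tsum _ fun k _ => hu k
  have hsum := sum_range_succ_renewal u N
  rw [Finset.sum_range_succ, ← hS] at hsum
  rw [le_div_iff₀ (by linarith)]
  linarith [ha N]

theorem one_add_mul_sum_renewal_le (hu : ∀ k, 0 ≤ u k) (K N : ℕ) :
    1 + (∑ k ∈ Finset.range K, u k) * ∑ n ∈ Finset.range N, renewal u n ≤
      ∑ n ∈ Finset.range (N + K + 1), renewal u n := by
  have ha := renewal_nonneg hu
  calc 1 + (∑ k ∈ Finset.range K, u k) * ∑ n ∈ Finset.range N, renewal u n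
      = 1 + ∑ k ∈ Finset.range K, u k * ∑ n ∈ Finset.range N, renewal u n := by
        rw [Finset.sum_mul]
    _ ≤ 1 + ∑ k ∈ Finset.range K, u k * ∑ n ∈ Finset.range (N + K - k), renewal u n := by
        gcongr with k hk
        · exact hu k
        · exact fun n _ _ => ha n
        · have := Finset.mem_range.1 hk
          lia
    _ ≤ 1 + ∑ k ∈ Finset.range (N + K), u k * ∑ n ∈ Finset.range (N + K - k), renewal u n := by
        gcongr
        · exact fun k _ _ => mul_nonneg (hu k) (Finset.sum_nonneg fun n _ => ha n)
        · lia
    _ = ∑ n ∈ Finset.range (N + K + 1), renewal u n := (sum_range_succ_renewal u (N + K)).symm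

theorem exists_one_lt_renewal (hu : ∀ k, 0 ≤ u k) {K : ℕ} (hK : 1 < ∑ k ∈ Finset.range K, u k) :
    ∃ n, 1 ≤ n ∧ 1 < renewal u n := by
  by_contra! hcon
  have hle_one : ∀ n, renewal u n ≤ 1 := fun n => by
    rcases Nat.eq_zero_or_pos n with rfl | hn
    · exact renewal_zero.le
    · exact hcon n hn
  set S : ℕ → ℝ := fun N => ∑ n ∈ Finset.range N, renewal u n with hS
  have hlower : ∀ N, 1 + (∑ k ∈ Finset.range K, u k) * S N ≤ S (N + K + 1) :=
    one_add_mul_sum_renewal_le hu K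
  have hupper : ∀ N, S (N + K + 1) ≤ S N + (K + 1) := fun N =>
    calc S (N + K + 1) = S N + ∑ i ∈ Finset.range (K + 1), renewal u (N + i) := by
          rw [hS, add_assoc]; exact Finset.sum_range_add _ N (K + 1)
      _ ≤ S N + ∑ i ∈ Finset.range (K + 1), 1 := by gcongr; exact hle_one _
      _ = S N + (K + 1) := by simp
  have hgrowth : ∀ j : ℕ, (j : ℝ) ≤ S (j * (K + 1)) := fun j => by
    induction j with
    | zero => simp [hS]
    | succ j ih =>
      rw [add_one_mul, ← add_assoc]
      push_cast
      nlinarith [hlower (j * (K + 1))]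
  obtain ⟨j, hj⟩ := exists_nat_gt ((K : ℝ) / (∑ k ∈ Finset.range K, u k - 1))
  rw [div_lt_iff₀ (by linarith)] at hj
  nlinarith [hlower (j * (K + 1)), hupper (j * (K + 1)), hgrowth j]

end Renewal

section SecondMoment

variable {Ω ι : Type*} [Fintype ι] {E : ι → Set Ω}

theorem two_mul_sum_sub_sum_le_indicator_iUnion (x : ι → ℝ) (ω : Ω) :
    2 * ∑ i, x i * (E i).indicator (1 : Ω → ℝ) ω -
      ∑ i, ∑ j, x i * x j * (E i ∩ E j).indicator (1 : Ω → ℝ) ω ≤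
        (⋃ i, E i).indicator (1 : Ω → ℝ) ω := by
  have hsq : ∑ i, ∑ j, x i * x j * (E i ∩ E j).indicator (1 : Ω → ℝ) ω =
      (∑ i, x i * (E i).indicator (1 : Ω → ℝ) ω) ^ 2 := by
    simp only [Set.inter_indicator_one, Pi.mul_apply, sq, Finset.sum_mul_sum, mul_mul_mul_comm]
  rw [hsq]
  by_cases hω : ω ∈ ⋃ i, E i
  · rw [Set.indicator_of_mem hω, Pi.one_apply]
    nlinarith [sq_nonneg (∑ i, x i * (E i).indicator (1 : Ω → ℝ) ω - 1)]
  · simp only [Set.mem_iUnion, not_exists] at hω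
    simp [hω]

variable [MeasurableSpace Ω] {P : Measure Ω} [IsFiniteMeasure P]

theorem two_mul_sum_sub_sum_le_measureReal_iUnion (hE : ∀ i, MeasurableSet (E i)) (x : ι → ℝ) :
    2 * ∑ i, x i * P.real (E i) - ∑ i, ∑ j, x i * x j * P.real (E i ∩ E j) ≤
      P.real (⋃ i, E i) := by
  have hint : ∀ {A : Set Ω}, MeasurableSet A → Integrable (A.indicator (1 : Ω → ℝ)) P := fun hA =>
    (integrable_const 1).indicator hA
  have hX : ∀ i, Integrable (fun ω => x i * (E i).indicator (1 : Ω → ℝ) ω) P := fun i =>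
    (hint (hE i)).const_mul _
  have hXX : ∀ i j, Integrable (fun ω => x i * x j * (E i ∩ E j).indicator (1 : Ω → ℝ) ω) P :=
    fun i j => (hint ((hE i).inter (hE j))).const_mul _
  have hsumX := (integrable_finsetSum Finset.univ fun i _ => hX i).const_mul 2
  have hsumXX := integrable_finsetSum Finset.univ fun i _ =>
    integrable_finsetSum Finset.univ fun j _ => hXX i j
  calc 2 * ∑ i, x i * P.real (E i) - ∑ i, ∑ j, x i * x j * P.real (E i ∩ E j)
      = ∫ ω, (2 * ∑ i, x i * (E i).indicator (1 : Ω → ℝ) ω -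
          ∑ i, ∑ j, x i * x j * (E i ∩ E j).indicator (1 : Ω → ℝ) ω) ∂P := by
        rw [integral_sub hsumX hsumXX, integral_const_mul, integral_finsetSum _ fun i _ => hX i,
          integral_finsetSum _ fun i _ => integrable_finsetSum _ fun j _ => hXX i j]
        simp only [integral_const_mul, integral_indicator_one (hE _),
          integral_finsetSum _ fun j _ => hXX _ j, integral_indicator_one ((hE _).inter (hE _))]
    _ ≤ ∫ ω, (⋃ i, E i).indicator (1 : Ω → ℝ) ω ∂P :=
        integral_mono (hsumX.sub hsumXX) (hint (.iUnion hE))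
          (two_mul_sum_sub_sum_le_indicator_iUnion x)
    _ = P.real (⋃ i, E i) := integral_indicator_one (.iUnion hE)

theorem le_measureReal_iUnion_of_inter_le (hE : ∀ i, MeasurableSet (E i)) {b : ι → ℝ} {p ε : ℝ}
    (hε : 0 < ε) (hp : 0 ≤ p) (hb : ∀ i, ε ≤ b i) (hEb : ∀ i, P.real (E i) = p * b i)
    (hEE : Pairwise fun i j => P.real (E i ∩ E j) ≤ p * (b i * b j))
    (hM : ε * Fintype.card ι * (Fintype.card ι * p) ≤ Fintype.card ι * p - 1) :
    ε ≤ P.real (⋃ i, E i) := by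
  classical
  have hb0 : ∀ i, 0 < b i := fun i => hε.trans_le (hb i)
  have hweight : ∀ i, 0 ≤ ε / b i := fun i => div_nonneg hε.le (hb0 i).le
  have hfirst : ∀ i, ε / b i * P.real (E i) = ε * p := fun i => by
    rw [hEb, mul_left_comm, div_mul_cancel₀ _ (hb0 i).ne', mul_comm]
  have hpair : ∀ i j, ε / b i * (ε / b j) * P.real (E i ∩ E j) ≤
      (if i = j then ε * p else 0) + ε ^ 2 * p := fun i j => by
    split_ifs with hij
    · subst hij
      rw [Set.inter_self, mul_assoc, hfirst]
      exact (mul_le_of_le_one_left (by positivity) ((div_le_one (hb0 i)).2 (hb i))).trans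
        (le_add_of_nonneg_right (by positivity))
    · calc ε / b i * (ε / b j) * P.real (E i ∩ E j)
          ≤ ε / b i * (ε / b j) * (p * (b i * b j)) :=
            mul_le_mul_of_nonneg_left (hEE hij) (mul_nonneg (hweight i) (hweight j))
        _ = 0 + ε ^ 2 * p := by
            field_simp [(hb0 i).ne', (hb0 j).ne']
            ring
  calc ε ≤ 2 * ∑ _i : ι, ε * p - ∑ i : ι, ∑ j : ι, ((if i = j then ε * p else 0) + ε ^ 2 * p) := by
        simp only [Finset.sum_add_distrib, Finset.sum_ite_eq, Finset.mem_univ, if_true,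
          Finset.sum_const, Finset.card_univ, nsmul_eq_mul]
        nlinarith
    _ ≤ 2 * ∑ i, ε / b i * P.real (E i) - ∑ i, ∑ j, ε / b i * (ε / b j) * P.real (E i ∩ E j) := by
        simp only [hfirst]
        gcongr with i _ j
        exact hpair i j
    _ ≤ P.real (⋃ i, E i) := two_mul_sum_sub_sum_le_measureReal_iUnion hE _

end SecondMoment

theorem indep_cylinderEvents_infinitePi {ι : Type*} {X : ι → Type*} [∀ i, MeasurableSpace (X i)]
    (μ : ∀ i, Measure (X i)) [∀ i, IsProbabilityMeasure (μ i)] {S T : Set ι} (h : Disjoint S T) :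
    Indep (cylinderEvents S) (cylinderEvents T) (Measure.infinitePi μ) :=
  indep_iSup_of_disjoint (fun i => (measurable_pi_apply i).comap_le)
    (iIndepFun_infinitePi (P := μ) (X := fun _ x => x) fun _ => measurable_id) h

variable {d : ℕ}

section Tree

/-- The parent of a vertex. The root is its own parent. -/
def Vertex.parent : Vertex d → Vertex d
  | .root => .root
  | .node _ [] => .root
  | .node i (_ :: l) => .node i l

/-- The ancestor of a vertex `k` generations above it; the root when `k` exceeds the level. -/
def Vertex.anc (k : ℕ) (w : Vertex d) : Vertex d := Vertex.parent^[k] w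

/-- The values of the step randomness for which a walk at the parent of `w` jumps to `w`. -/
def Vertex.stepSet : Vertex d → Set (Step d)
  | .root => ∅
  | .node i [] => {i} ×ˢ Set.univ
  | .node _ (j :: _) => Set.univ ×ˢ {j}

/-- The descendants of `v` that are `m` generations below it. -/
def Vertex.descendants (v : Vertex d) (m : ℕ) : Set (Vertex d) :=
  {u | u.level = v.level + m ∧ u.anc m = v}

/-- The vertices of the subtree rooted at `v`. -/
def Vertex.subtree (v : Vertex d) : Set (Vertex d) := ⋃ m, v.descendants m

@[simp]
theorem Vertex.anc_zero (w : Vertex d) : w.anc 0 = w := rfl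

theorem Vertex.anc_add (j k : ℕ) (w : Vertex d) : w.anc (j + k) = (w.anc k).anc j :=
  Function.iterate_add_apply _ _ _ _

theorem Vertex.anc_succ (k : ℕ) (w : Vertex d) : w.anc (k + 1) = w.parent.anc k :=
  Function.iterate_succ_apply _ _ _

theorem Vertex.level_parent (w : Vertex d) : w.parent.level = w.level - 1 := by
  rcases w with _ | ⟨i, _ | ⟨j, l⟩⟩ <;> rfl

@[simp]
theorem Vertex.level_anc (k : ℕ) (w : Vertex d) : (w.anc k).level = w.level - k := by
  induction k generalizing w with
  | zero => rfl
  | succ k ih => rw [anc_succ, ih, level_parent]; lia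

theorem Vertex.child_eq_iff (u w : Vertex d) (x : Step d) :
    u.child x = w ↔ u = w.parent ∧ 1 ≤ w.level ∧ x ∈ w.stepSet := by
  rcases u with _ | ⟨i, l⟩ <;> rcases w with _ | ⟨i', _ | ⟨j, l'⟩⟩ <;>
    grind [Vertex.child, Vertex.parent, Vertex.stepSet, Vertex.level]

theorem walk_eq_iff (u w : Vertex d) (ξ : ℕ → Step d) (k : ℕ) :
    walk u ξ k = w ↔ u = w.anc k ∧ k ≤ w.level ∧ ∀ i < k, ξ i ∈ (w.anc (k - 1 - i)).stepSet := by
  induction k generalizing w with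
  | zero => simp [walk]
  | succ k ih =>
    have hsteps : (∀ i < k, ξ i ∈ (w.parent.anc (k - 1 - i)).stepSet) ↔
        ∀ i < k, ξ i ∈ (w.anc (k + 1 - 1 - i)).stepSet :=
      forall₂_congr fun i hi => by
        rw [← Vertex.anc_succ, show k - 1 - i + 1 = k + 1 - 1 - i by lia]
    rw [walk, Vertex.child_eq_iff, ih, Vertex.level_parent, hsteps, Nat.forall_lt_succ_right,
      ← Vertex.anc_succ]
    simp only [Nat.add_sub_cancel, Nat.sub_self, Vertex.anc_zero]
    lia

theorem Vertex.descendants_zero (v : Vertex d) : v.descendants 0 = {v} := by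
  ext u
  simp only [descendants, anc_zero, Set.mem_ofPred_eq, Set.mem_singleton_iff]
  exact ⟨And.right, fun h => ⟨by rw [h, Nat.add_zero], h⟩⟩

theorem Vertex.mem_descendants_succ {u v : Vertex d} {m : ℕ} :
    u ∈ v.descendants (m + 1) ↔ 1 ≤ u.level ∧ u.parent ∈ v.descendants m := by
  simp only [descendants, Set.mem_ofPred_eq, level_parent, anc_succ]
  lia

theorem Vertex.descendants_node (i : Fin (d + 1)) (l : List (Fin d)) (m : ℕ) :
    (Vertex.node i l).descendants m =
      Set.range fun g : List.Vector (Fin d) m => .node i (g.toList ++ l) := by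
  ext u
  rw [Set.mem_range]
  constructor
  · intro hu
    induction m generalizing u with
    | zero => exact ⟨.nil, by simpa [descendants_zero, eq_comm] using hu⟩
    | succ m ih =>
      obtain ⟨hlevel, hparent⟩ := mem_descendants_succ.1 hu
      obtain ⟨g, hg⟩ := ih u.parent hparent
      rcases u with _ | ⟨i', _ | ⟨j, l'⟩⟩
      · exact absurd hlevel (by simp [level])
      · exact absurd hg (by simp [parent])
      · obtain ⟨rfl, rfl⟩ := Vertex.node.inj hg
        exact ⟨j ::ᵥ g, by simp⟩
  · rintro ⟨g, rfl⟩
    induction m with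
    | zero => simp [descendants_zero, g.eq_nil]
    | succ m ih =>
      obtain ⟨j, g, rfl⟩ := g.exists_eq_cons
      exact mem_descendants_succ.2 ⟨by simp [level], by simpa [parent] using ih g⟩

theorem Vertex.ncard_descendants {v : Vertex d} (hv : 1 ≤ v.level) (m : ℕ) :
    (v.descendants m).ncard = d ^ m := by
  rcases v with _ | ⟨i, l⟩
  · exact absurd hv (by simp [level])
  · rw [descendants_node, Set.ncard_range_of_injective, Nat.card_eq_fintype_card, card_vector,
      Fintype.card_fin]
    exact fun g g' h => List.Vector.toList_injective (by simpa using h)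

theorem Vertex.finite_descendants {v : Vertex d} (hv : 1 ≤ v.level) (m : ℕ) :
    (v.descendants m).Finite := by
  rcases v with _ | ⟨i, l⟩
  · exact absurd hv (by simp [level])
  · rw [descendants_node]
    exact Set.finite_range _

theorem Vertex.mem_descendants_anc {w : Vertex d} {m : ℕ} (hm : m ≤ w.level) :
    w ∈ (w.anc m).descendants m :=
  ⟨by rw [level_anc]; lia, rfl⟩

theorem Vertex.mem_descendants_add {u v w : Vertex d} {m n : ℕ} (hu : u ∈ v.descendants m)
    (hw : w ∈ u.descendants n) : w ∈ v.descendants (m + n) :=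
  ⟨by rw [hw.1, hu.1, Nat.add_assoc], by rw [anc_add, hw.2, hu.2]⟩

theorem Vertex.subtree_subset {u v : Vertex d} {m : ℕ} (hu : u ∈ v.descendants m) :
    u.subtree ⊆ v.subtree :=
  Set.iUnion_subset fun n _ hw => Set.mem_iUnion.2 ⟨m + n, mem_descendants_add hu hw⟩

theorem Vertex.level_le_of_mem_subtree {v w : Vertex d} (hw : w ∈ v.subtree) :
    v.level ≤ w.level := by
  obtain ⟨m, hm⟩ := Set.mem_iUnion.1 hw
  exact hm.1 ▸ Nat.le_add_right _ _

theorem Vertex.disjoint_subtree {u v : Vertex d} (hl : u.level = v.level) (h : u ≠ v) :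
    Disjoint u.subtree v.subtree := by
  rw [Set.disjoint_left]
  intro w hu hv
  obtain ⟨m, hm, rfl⟩ := Set.mem_iUnion.1 hu
  obtain ⟨n, hn, rfl⟩ := Set.mem_iUnion.1 hv
  exact h (by rw [show m = n by lia])

end Tree

section Activation

variable {ω : Config d}

/-- The walk of the `k`-th ancestor of `w` goes through `w` within the lifetime of that ancestor. -/
def Hit (ω : Config d) (k : ℕ) (w : Vertex d) : Prop :=
  k ≤ (ω (w.anc k)).1 ∧ walk (w.anc k) (ω (w.anc k)).2 k = w

/-- The activation of the `n`-th ancestor of `w` leads to that of `w`, through a chain of vertices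
each of which is visited by the particle of the preceding one. -/
inductive Reach (ω : Config d) : ℕ → Vertex d → Prop
  | refl (w : Vertex d) : Reach ω 0 w
  | step {n k : ℕ} {w : Vertex d} (h : Reach ω n (w.anc (k + 1))) (hk : Hit ω (k + 1) w) :
      Reach ω (n + (k + 1)) w

theorem Hit.anc {j k : ℕ} {w : Vertex d} (h : Hit ω (j + k) w) : Hit ω j (w.anc k) := by
  obtain ⟨hlife, hwalk⟩ := h
  obtain ⟨-, hlevel, hsteps⟩ := (walk_eq_iff _ _ _ _).1 hwalk
  rw [Vertex.anc_add] at hlife hsteps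
  refine ⟨by lia, (walk_eq_iff _ _ _ _).2 ⟨rfl, by rw [Vertex.level_anc]; lia, fun i hi => ?_⟩⟩
  rw [← Vertex.anc_add, show j - 1 - i + k = j + k - 1 - i by lia]
  exact hsteps i (by lia)

theorem Reach.trans {m n : ℕ} {w : Vertex d} (hm : Reach ω m w) (hn : Reach ω n (w.anc m)) :
    Reach ω (n + m) w := by
  induction hm with
  | refl w => exact hn
  | @step m k w _ hk ih =>
    rw [← Nat.add_assoc]
    exact .step (ih (by rwa [← Vertex.anc_add])) hk

theorem Reach.exists_hit {n : ℕ} {w : Vertex d} (h : Reach ω (n + 1) w) :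
    ∃ k ≤ n, Reach ω (n - k) (w.anc (k + 1)) ∧ Hit ω (k + 1) w := by
  generalize hm : n + 1 = m at h
  cases h with
  | refl => lia
  | @step m k _ h hk => exact ⟨k, by lia, by rwa [show n - k = m by lia], hk⟩

theorem Reach.of_hit {n k : ℕ} {w : Vertex d} (hk : k ≤ n) (h : Reach ω (n - k) (w.anc (k + 1)))
    (hw : Hit ω (k + 1) w) : Reach ω (n + 1) w := by
  rw [show n + 1 = n - k + (k + 1) by lia]
  exact h.step hw

theorem Reach.anc_of_hit {n j k : ℕ} {w : Vertex d} (hkj : k ≤ j) (hjn : j ≤ n)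
    (h : Reach ω (n - j) (w.anc (j + 1))) (hj : Hit ω (j + 1) w) :
    Reach ω (n - k) (w.anc (k + 1)) := by
  obtain ⟨i, rfl⟩ := Nat.exists_eq_add_of_le' hkj
  rcases i with _ | i
  · simpa using h
  · have hanc : Hit ω (i + 1) (w.anc (k + 1)) := Hit.anc (by rwa [← Nat.add_assoc])
    rw [show n - k = n - (i + 1 + k) + (i + 1) by lia]
    exact .step (by rwa [← Vertex.anc_add, ← Nat.add_assoc]) hanc

/-- Whichever ancestor activates `w`, the closest ancestor whose particle visits `w` has been
activated as well, since the former also visits the latter. -/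
theorem reach_succ_iff {n : ℕ} {w : Vertex d} :
    Reach ω (n + 1) w ↔ ∃ k ≤ n, Reach ω (n - k) (w.anc (k + 1)) ∧ Hit ω (k + 1) w ∧
      ∀ i < k, ¬ Hit ω (i + 1) w := by
  constructor
  · intro h
    obtain ⟨j, hj, hreach, hhit⟩ := h.exists_hit
    classical
    have hex : ∃ k, Hit ω (k + 1) w := ⟨j, hhit⟩
    have hle : Nat.find hex ≤ j := Nat.find_min' hex hhit
    exact ⟨Nat.find hex, hle.trans hj, .anc_of_hit hle hj hreach hhit, Nat.find_spec hex,
      fun _ => Nat.find_min hex⟩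
  · rintro ⟨k, hk, hreach, hhit, -⟩
    exact .of_hit hk hreach hhit

theorem ActivatedAt.reach {w : Vertex d} {t : ℕ} (h : ActivatedAt ω w t) : Reach ω t w := by
  induction h with
  | root => exact .refl _
  | @visit u s n _ hn ih =>
    rcases n with _ | n
    · exact ih
    · have hanc := ((walk_eq_iff u _ (ω u).2 (n + 1)).1 rfl).1
      exact .step (hanc ▸ ih) ⟨hanc ▸ hn, by rw [← hanc]⟩

theorem Reach.activatedAt {n : ℕ} {w : Vertex d} (h : Reach ω n w) (hn : w.level = n) :
    ActivatedAt ω w n := by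
  induction h with
  | refl w =>
    rcases w with _ | ⟨i, l⟩
    · exact .root
    · exact absurd hn (Nat.succ_ne_zero _)
  | @step n k w _ hk ih =>
    have hvisit := (ih (by rw [Vertex.level_anc]; lia)).visit hk.1
    rwa [hk.2] at hvisit

theorem Survives.exists_reach (h : Survives ω) (n : ℕ) : ∃ w, w.level = n ∧ Reach ω n w := by
  obtain ⟨v, s, hv, hsn, hns⟩ := h n
  have hvisit := hv.visit (n := n - s) (by lia)
  rw [Nat.add_sub_cancel' hsn] at hvisit
  exact ⟨_, hvisit.eq_level.symm, hvisit.reach⟩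

theorem ActivatedAt.exists_active {w : Vertex d} {n t : ℕ} (h : ActivatedAt ω w n) (ht : t ≤ n) :
    ∃ v s, ActivatedAt ω v s ∧ s ≤ t ∧ t ≤ s + (ω v).1 := by
  induction h with
  | root => exact ⟨.root, 0, .root, t.zero_le, by lia⟩
  | @visit u s n hu hn ih =>
    by_cases hts : t ≤ s
    · exact ih hts
    · exact ⟨u, s, hu, by lia, by lia⟩

theorem survives_of_forall_exists_reach (h : ∀ n, ∃ w, n ≤ w.level ∧ Reach ω w.level w) :
    Survives ω := fun t => by
  obtain ⟨w, htw, hw⟩ := h t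
  exact (hw.activatedAt rfl).exists_active htw

end Activation

section Measurability

/-- The values of the randomness of the particle of the `k`-th ancestor of `w` for which it visits
`w`. -/
def hitSet (k : ℕ) (w : Vertex d) : Set (Particle d) := {p | k ≤ p.1 ∧ walk (w.anc k) p.2 k = w}

/-- The ancestors of `w` that are at least `a + 1` and at most `b` generations above it. -/
def ancestors (w : Vertex d) (a b : ℕ) : Set (Vertex d) := (fun i => w.anc i) '' Set.Ioc a b

theorem hitSet_eq_prod {k : ℕ} {w : Vertex d} (hk : k ≤ w.level) :
    hitSet k w =
      Set.Ici k ×ˢ Set.pi (Finset.range k) fun i => (w.anc (k - 1 - i)).stepSet := by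
  ext p
  simp [hitSet, walk_eq_iff, hk]

theorem measurableSet_hitSet (k : ℕ) (w : Vertex d) : MeasurableSet (hitSet k w) := by
  by_cases hk : k ≤ w.level
  · rw [hitSet_eq_prod hk]
    exact MeasurableSet.of_discrete.prod
      (.pi (Finset.countable_toSet _) fun _ _ => MeasurableSet.of_discrete)
  · simp [hitSet, walk_eq_iff, hk]

theorem ancestors_mono (w : Vertex d) {a b a' b' : ℕ} (ha : a' ≤ a) (hb : b ≤ b') :
    ancestors w a b ⊆ ancestors w a' b' :=
  Set.image_mono (Set.Ioc_subset_Ioc ha hb)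

theorem ancestors_anc_subset (w : Vertex d) {m n b : ℕ} (hb : m + n ≤ b) :
    ancestors (w.anc m) 0 n ⊆ ancestors w m b := by
  rintro _ ⟨i, ⟨hi0, hin⟩, rfl⟩
  exact ⟨i + m, ⟨by lia, by lia⟩, Vertex.anc_add _ _ _⟩

theorem disjoint_ancestors {w : Vertex d} {a b c : ℕ} (hc : c ≤ w.level) :
    Disjoint (ancestors w a b) (ancestors w b c) := by
  rw [Set.disjoint_left]
  rintro _ ⟨i, ⟨-, hib⟩, rfl⟩ ⟨j, ⟨hbj, hjc⟩, hij⟩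
  have hlevel := congrArg Vertex.level hij
  simp only [Vertex.level_anc] at hlevel
  lia

theorem level_lt_of_mem_ancestors {u w : Vertex d} {a b : ℕ} (hb : b ≤ w.level)
    (hu : u ∈ ancestors w a b) : u.level < w.level := by
  obtain ⟨i, ⟨hai, hib⟩, rfl⟩ := hu
  rw [Vertex.level_anc]
  lia

theorem measurableSet_hit {a b k : ℕ} (w : Vertex d) (ha : a < k) (hb : k ≤ b) :
    MeasurableSet[cylinderEvents (ancestors w a b)] {ω : Config d | Hit ω k w} :=
  have hk : w.anc k ∈ ancestors w a b := ⟨k, ⟨ha, hb⟩, rfl⟩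
  measurable_cylinderEvent_apply (X := fun _ : Vertex d => Particle d) hk (measurableSet_hitSet k w)

theorem measurableSet_forall_not_hit (k : ℕ) (w : Vertex d) :
    MeasurableSet[cylinderEvents (ancestors w 0 k)]
      {ω : Config d | ∀ i < k, ¬ Hit ω (i + 1) w} := by
  simp only [Set.ofPred_forall]
  exact .iInter fun i => .iInter fun hi => (measurableSet_hit w i.succ_pos hi).compl

theorem measurableSet_reach (n : ℕ) (w : Vertex d) :
    MeasurableSet[cylinderEvents (ancestors w 0 n)] {ω : Config d | Reach ω n w} := by
  induction n using Nat.strong_induction_on generalizing w with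
  | _ n ih =>
    rcases n with _ | n
    · simp [Reach.refl]
    · have hreach : {ω : Config d | Reach ω (n + 1) w} = ⋃ k, ⋃ _ : k ≤ n,
          {ω | Reach ω (n - k) (w.anc (k + 1))} ∩ {ω | Hit ω (k + 1) w} := by
        ext ω
        simp only [Set.mem_ofPred_eq, Set.mem_iUnion, Set.mem_inter_iff, exists_prop]
        exact ⟨Reach.exists_hit, fun ⟨k, hk, hr, hh⟩ => .of_hit hk hr hh⟩
      rw [hreach]
      refine .iUnion fun k => .iUnion fun hk => .inter ?_ (measurableSet_hit w k.succ_pos (by lia))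
      exact cylinderEvents_mono ((ancestors_anc_subset w le_rfl).trans
        (ancestors_mono w (Nat.zero_le _) (by lia))) _ (ih (n - k) (by lia) (w.anc (k + 1)))

end Measurability

section HittingProbabilities

variable {c q : ℝ}

/-- The probability that none of the particles of the `k` closest ancestors of a vertex visits it,
if all of them are activated. -/
noncomputable def missProb (c q : ℝ) (k : ℕ) : ℝ := ∏ i ∈ Finset.range k, (1 - c * q ^ (i + 1))

/-- The probability that, among the particles of all the ancestors of a vertex, the closest one that
visits the vertex, if activated, is `k + 1` generations above it. -/
noncomputable def firstHitProb (c q : ℝ) (k : ℕ) : ℝ := c * q ^ (k + 1) * missProb c q k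

instance (h : Admissible d c q) : IsProbabilityMeasure (frogLaw h) := by
  unfold frogLaw
  infer_instance

theorem Admissible.q_le_half (h : Admissible d c q) : q ≤ 1 / 2 := by
  have hd : (2 : ℝ) ≤ d := by exact_mod_cast h.two_le
  nlinarith [h.q_pos, h.dq_lt_one]

theorem Admissible.q_le_one (h : Admissible d c q) : q ≤ 1 := h.q_le_half.trans one_half_lt_one.le

theorem missProb_nonneg (hc : c ≤ 1) (hq : 0 ≤ q) (hq' : q ≤ 1) (k : ℕ) : 0 ≤ missProb c q k :=
  Finset.prod_nonneg fun i _ => sub_nonneg.2 <|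
    mul_le_one₀ hc (by positivity) (pow_le_one₀ hq hq')

theorem firstHitProb_nonneg (hc : 0 ≤ c) (hc' : c ≤ 1) (hq : 0 ≤ q) (hq' : q ≤ 1) (k : ℕ) :
    0 ≤ firstHitProb c q k :=
  mul_nonneg (by positivity) (missProb_nonneg hc' hq hq' k)

theorem frogLaw_real_inter (h : Admissible d c q) {S T : Set (Vertex d)} (hST : Disjoint S T)
    {A B : Set (Config d)} (hA : MeasurableSet[cylinderEvents S] A)
    (hB : MeasurableSet[cylinderEvents T] B) :
    (frogLaw h).real (A ∩ B) = (frogLaw h).real A * (frogLaw h).real B := by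
  have hindep : Indep (cylinderEvents S) (cylinderEvents T) (frogLaw h) :=
    indep_cylinderEvents_infinitePi _ hST
  rw [Measure.real, (Indep_iff _ _ _).1 hindep A B hA hB, ENNReal.toReal_mul]
  rfl

theorem stepLaw_real_prod (s : Set (Fin (d + 1))) (t : Set (Fin d)) :
    (stepLaw d).real (s ×ˢ t) = (s.ncard / (d + 1)) * (t.ncard / d) := by
  rw [Measure.real, stepLaw, uniformOn_univ, Measure.count_apply_finite _ (Set.toFinite _),
    ← Set.ncard_eq_toFinset_card, Set.ncard_prod, div_mul_div_comm]
  simp [ENNReal.toReal_add]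

theorem stepLaw_real_stepSet {w : Vertex d} (hw : 2 ≤ w.level) :
    (stepLaw d).real w.stepSet = (d : ℝ)⁻¹ := by
  rcases w with _ | ⟨i, _ | ⟨j, l⟩⟩
  · simp [Vertex.level] at hw
  · simp [Vertex.level] at hw
  · rw [Vertex.stepSet, stepLaw_real_prod, Set.ncard_univ, Set.ncard_singleton, Nat.card_fin]
    field_simp
    simp

theorem stepLaw_real_stepSet_node_nil (hd : d ≠ 0) (i : Fin (d + 1)) :
    (stepLaw d).real (Vertex.node i []).stepSet = ((d : ℝ) + 1)⁻¹ := by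
  rw [Vertex.stepSet, stepLaw_real_prod, Set.ncard_univ, Set.ncard_singleton, Nat.card_fin]
  field_simp
  simp

theorem stepLaw_real_stepSet_le (hd : d ≠ 0) (w : Vertex d) :
    (stepLaw d).real w.stepSet ≤ (d : ℝ)⁻¹ := by
  rcases w with _ | ⟨i, _ | ⟨j, l⟩⟩
  · simp [Vertex.stepSet]
  · rw [stepLaw_real_stepSet_node_nil hd]
    gcongr
    exact le_add_of_nonneg_right zero_le_one
  · exact (stepLaw_real_stepSet (by simp [Vertex.level])).le

theorem frogLaw_real_hit (h : Admissible d c q) {k : ℕ} {w : Vertex d} (hk : k + 1 ≤ w.level) :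
    (frogLaw h).real {ω | Hit ω (k + 1) w} = c * (d * q) ^ (k + 1) *
      ∏ i ∈ Finset.range (k + 1), (stepLaw d).real (w.anc i).stepSet := by
  have := h.isProbabilityMeasure_stepLaw
  have hlaw : frogLaw h {ω | Hit ω (k + 1) w} = particleLaw h (hitSet (k + 1) w) :=
    (measurePreserving_eval_infinitePi (fun _ : Vertex d => particleLaw h)
      (w.anc (k + 1))).measure_preimage (measurableSet_hitSet (k + 1) w).nullMeasurableSet
  have hlife : (lifetime h).toMeasure (Set.Ici (k + 1)) = ENNReal.ofReal (c * (d * q) ^ (k + 1)) :=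
    lifetime_tail h (k + 1) k.succ_pos
  rw [Measure.real, hlaw, hitSet_eq_prod hk, particleLaw, Measure.prod_prod, hlife,
    Measure.infinitePi_pi _ fun _ _ => MeasurableSet.of_discrete, ENNReal.toReal_mul,
    ENNReal.toReal_ofReal (mul_nonneg h.c_pos.le (pow_nonneg h.dq_pos.le _)), ENNReal.toReal_prod]
  congr 1
  exact Finset.prod_range_reflect (fun i => (stepLaw d).real (w.anc i).stepSet) (k + 1)

theorem mul_pow_mul_inv_pow (h : Admissible d c q) (k : ℕ) :
    c * (d * q) ^ k * (d : ℝ)⁻¹ ^ k = c * q ^ k := by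
  have hd : (d : ℝ) ≠ 0 := by have := h.two_le; positivity
  rw [mul_assoc, ← mul_pow, mul_right_comm, mul_inv_cancel₀ hd, one_mul]

theorem frogLaw_real_hit_of_lt (h : Admissible d c q) {k : ℕ} {w : Vertex d}
    (hk : k + 1 < w.level) : (frogLaw h).real {ω | Hit ω (k + 1) w} = c * q ^ (k + 1) := by
  have hstep : ∀ i ∈ Finset.range (k + 1), (stepLaw d).real (w.anc i).stepSet = (d : ℝ)⁻¹ :=
    fun i hi => stepLaw_real_stepSet (by
      rw [Vertex.level_anc]
      have := Finset.mem_range.1 hi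
      lia)
  rw [frogLaw_real_hit h hk.le, Finset.prod_congr rfl hstep, Finset.prod_const, Finset.card_range,
    mul_pow_mul_inv_pow h]

theorem frogLaw_real_hit_le (h : Admissible d c q) {k : ℕ} {w : Vertex d} (hk : k + 1 ≤ w.level) :
    (frogLaw h).real {ω | Hit ω (k + 1) w} ≤ c * q ^ (k + 1) := by
  have hc := h.c_pos
  have hdq := h.dq_pos
  calc (frogLaw h).real {ω | Hit ω (k + 1) w}
      ≤ c * (d * q) ^ (k + 1) * ∏ _i ∈ Finset.range (k + 1), (d : ℝ)⁻¹ := by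
        rw [frogLaw_real_hit h hk]
        gcongr
        exact stepLaw_real_stepSet_le (by have := h.two_le; lia) _
    _ = c * q ^ (k + 1) := by
        rw [Finset.prod_const, Finset.card_range, mul_pow_mul_inv_pow h]

theorem frogLaw_real_hit_one_pos (h : Admissible d c q) (i : Fin (d + 1)) :
    0 < (frogLaw h).real {ω | Hit ω 1 (.node i [])} := by
  have hc := h.c_pos
  have hdq := h.dq_pos
  rw [frogLaw_real_hit h (k := 0) (by simp [Vertex.level]), Finset.prod_range_one, Vertex.anc_zero,
    stepLaw_real_stepSet_node_nil (by have := h.two_le; lia)]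
  positivity

theorem frogLaw_real_forall_not_hit (h : Admissible d c q) {k : ℕ} {w : Vertex d}
    (hk : k < w.level) :
    (frogLaw h).real {ω | ∀ i < k, ¬ Hit ω (i + 1) w} = missProb c q k := by
  induction k with
  | zero => simp [missProb]
  | succ k ih =>
    have hsplit : {ω : Config d | ∀ i < k + 1, ¬ Hit ω (i + 1) w} =
        {ω | ∀ i < k, ¬ Hit ω (i + 1) w} ∩ {ω | Hit ω (k + 1) w}ᶜ := by
      ext ω
      exact Nat.forall_lt_succ_right
    have hhit := measurableSet_hit w k.lt_succ_self le_rfl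
    rw [hsplit, frogLaw_real_inter h (disjoint_ancestors hk.le) (measurableSet_forall_not_hit k w)
      hhit.compl, ih (by lia), probReal_compl_eq_one_sub (cylinderEvents_le_pi _ hhit),
      frogLaw_real_hit_of_lt h hk, missProb, missProb, Finset.prod_range_succ]

theorem frogLaw_real_reach_firstHit (h : Admissible d c q) {n k : ℕ} {w : Vertex d}
    (hn : n + 1 ≤ w.level) (hk : k ≤ n) :
    (frogLaw h).real {ω | Reach ω (n - k) (w.anc (k + 1)) ∧ Hit ω (k + 1) w ∧
      ∀ i < k, ¬ Hit ω (i + 1) w} = (frogLaw h).real {ω | Hit ω (k + 1) w} * missProb c q k *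
        (frogLaw h).real {ω | Reach ω (n - k) (w.anc (k + 1))} := by
  have hfirst : MeasurableSet[cylinderEvents (ancestors w 0 (k + 1))]
      ({ω : Config d | Hit ω (k + 1) w} ∩ {ω | ∀ i < k, ¬ Hit ω (i + 1) w}) :=
    .inter (measurableSet_hit w k.succ_pos le_rfl)
      (cylinderEvents_mono (ancestors_mono w le_rfl k.le_succ) _ (measurableSet_forall_not_hit k w))
  have hreach := cylinderEvents_mono (ancestors_anc_subset w (b := n + 1) (by lia)) _
    (measurableSet_reach (n - k) (w.anc (k + 1)))
  calc _ = (frogLaw h).real {ω | Reach ω (n - k) (w.anc (k + 1))} *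
        (frogLaw h).real ({ω | Hit ω (k + 1) w} ∩ {ω | ∀ i < k, ¬ Hit ω (i + 1) w}) :=
        frogLaw_real_inter h (disjoint_ancestors hn).symm hreach hfirst
    _ = _ := by
        rw [frogLaw_real_inter h (disjoint_ancestors (by lia)).symm
          (measurableSet_hit w k.lt_succ_self le_rfl) (measurableSet_forall_not_hit k w),
          frogLaw_real_forall_not_hit h (by lia), mul_comm]

theorem frogLaw_real_reach_succ (h : Admissible d c q) {n : ℕ} {w : Vertex d}
    (hn : n + 1 ≤ w.level) :
    (frogLaw h).real {ω | Reach ω (n + 1) w} = ∑ k ∈ Finset.range (n + 1),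
      (frogLaw h).real {ω | Hit ω (k + 1) w} * missProb c q k *
        (frogLaw h).real {ω | Reach ω (n - k) (w.anc (k + 1))} := by
  have hunion : {ω : Config d | Reach ω (n + 1) w} = ⋃ k ∈ Finset.range (n + 1),
      {ω | Reach ω (n - k) (w.anc (k + 1)) ∧ Hit ω (k + 1) w ∧ ∀ i < k, ¬ Hit ω (i + 1) w} := by
    ext ω
    simp only [Set.mem_ofPred_eq, reach_succ_iff, Set.mem_iUnion, Finset.mem_range_succ_iff,
      exists_prop]
  rw [hunion, measureReal_biUnion_finset]
  · exact Finset.sum_congr rfl fun k hk =>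
      frogLaw_real_reach_firstHit h hn (Finset.mem_range_succ_iff.1 hk)
  · intro i _ j _ hij
    rw [Function.onFun, Set.disjoint_left]
    rintro ω ⟨-, hhit, hmiss⟩ ⟨-, hhit', hmiss'⟩
    rcases lt_or_gt_of_ne hij with hlt | hlt
    · exact hmiss' i hlt hhit
    · exact hmiss j hlt hhit'
  · intro k _
    exact (cylinderEvents_le_pi _ (measurableSet_reach _ _)).inter
      ((cylinderEvents_le_pi _ (measurableSet_hit w k.succ_pos le_rfl)).inter
        (cylinderEvents_le_pi _ (measurableSet_forall_not_hit k w)))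

theorem frogLaw_real_reach_of_lt (h : Admissible d c q) {n : ℕ} {w : Vertex d} (hn : n < w.level) :
    (frogLaw h).real {ω | Reach ω n w} = renewal (firstHitProb c q) n := by
  induction n using Nat.strong_induction_on generalizing w with
  | _ n ih =>
    rcases n with _ | n
    · simp [Reach.refl]
    · rw [frogLaw_real_reach_succ h hn.le, renewal_succ]
      refine Finset.sum_congr rfl fun k hk => ?_
      have hkn := Finset.mem_range_succ_iff.1 hk
      rw [frogLaw_real_hit_of_lt h (by lia), firstHitProb,
        ih (n - k) (by lia) (by rw [Vertex.level_anc]; lia)]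

theorem frogLaw_real_reach_le (h : Admissible d c q) {n : ℕ} {w : Vertex d} (hn : n ≤ w.level) :
    (frogLaw h).real {ω | Reach ω n w} ≤ renewal (firstHitProb c q) n := by
  have hc := h.c_pos
  have hq := h.q_pos
  have hmiss := missProb_nonneg h.c_le_one hq.le h.q_le_one
  induction n using Nat.strong_induction_on generalizing w with
  | _ n ih =>
    rcases n with _ | n
    · simp [Reach.refl]
    · rw [frogLaw_real_reach_succ h hn, renewal_succ]
      refine Finset.sum_le_sum fun k hk => ?_
      have hkn := Finset.mem_range_succ_iff.1 hk
      have := hmiss k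
      rw [firstHitProb]
      gcongr
      · exact frogLaw_real_hit_le h (by lia)
      · exact ih (n - k) (by lia) (by rw [Vertex.level_anc]; lia)

end HittingProbabilities

section Branching

variable {ω : Config d} {c q : ℝ} {j m : ℕ} {u v : Vertex d}

/-- Survival until generation `j` of the branching process that starts from `v` and in which the
children of a vertex are those of its descendants `m` generations below it whose activation follows
from its own. -/
def BlockSurvives (ω : Config d) (m : ℕ) : ℕ → Vertex d → Prop
  | 0, _ => True
  | j + 1, v => ∃ u ∈ v.descendants m, Reach ω m u ∧ BlockSurvives ω m j u

theorem BlockSurvives.of_succ (h : BlockSurvives ω m (j + 1) v) : BlockSurvives ω m j v := by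
  induction j generalizing v with
  | zero => trivial
  | succ j ih =>
    obtain ⟨u, hu, hreach, hsurv⟩ := h
    exact ⟨u, hu, hreach, ih hsurv⟩

theorem BlockSurvives.exists_reach (h : BlockSurvives ω m j v) :
    ∃ w ∈ v.descendants (m * j), Reach ω (m * j) w := by
  induction j generalizing v with
  | zero => exact ⟨v, by simp [Vertex.descendants_zero], .refl v⟩
  | succ j ih =>
    obtain ⟨u, hu, hreach, hsurv⟩ := h
    obtain ⟨w, hw, hw'⟩ := ih hsurv
    rw [Nat.mul_succ, Nat.add_comm]
    exact ⟨w, Vertex.mem_descendants_add hu hw, hw'.trans (hw.2.symm ▸ hreach)⟩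

theorem survives_of_forall_blockSurvives (hm : 1 ≤ m) {i : Fin (d + 1)}
    (hhit : Hit ω 1 (.node i [])) (h : ∀ j, BlockSurvives ω m j (.node i [])) : Survives ω := by
  refine survives_of_forall_exists_reach fun n => ?_
  obtain ⟨w, hw, hreach⟩ := (h n).exists_reach
  have hlevel : w.level = 1 + m * n := hw.1
  refine ⟨w, by nlinarith, ?_⟩
  rw [hlevel]
  exact hreach.trans (hw.2.symm ▸ Reach.of_hit le_rfl (.refl _) hhit)

theorem ancestors_subset_subtree (hu : u ∈ v.descendants m) : ancestors u 0 m ⊆ v.subtree := by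
  rintro _ ⟨i, ⟨-, him⟩, rfl⟩
  refine Set.mem_iUnion.2 ⟨m - i, ?_, ?_⟩
  · rw [Vertex.level_anc, hu.1]
    lia
  · rw [← Vertex.anc_add, Nat.sub_add_cancel him, hu.2]

theorem measurableSet_blockSurvives (m j : ℕ) (hv : 1 ≤ v.level) :
    MeasurableSet[cylinderEvents v.subtree] {ω : Config d | BlockSurvives ω m j v} := by
  induction j generalizing v with
  | zero => simp [BlockSurvives]
  | succ j ih =>
    have hunion : {ω : Config d | BlockSurvives ω m (j + 1) v} = ⋃ u ∈ v.descendants m,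
        {ω | Reach ω m u} ∩ {ω | BlockSurvives ω m j u} := by
      ext ω
      simp only [Set.mem_ofPred_eq, BlockSurvives, Set.mem_iUnion, Set.mem_inter_iff, exists_prop]
    rw [hunion]
    refine .biUnion (Vertex.finite_descendants hv m).countable fun u hu => .inter ?_ ?_
    · exact cylinderEvents_mono (ancestors_subset_subtree hu) _ (measurableSet_reach m u)
    · exact cylinderEvents_mono (Vertex.subtree_subset hu) _ (ih (by rw [hu.1]; lia))

theorem measurableSet_reach_of_mem_descendants (hv : 1 ≤ v.level) (hu : u ∈ v.descendants m) :
    MeasurableSet[cylinderEvents {w | w.level < v.level + m}] {ω : Config d | Reach ω m u} := by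
  refine cylinderEvents_mono (fun w hw => ?_) _ (measurableSet_reach m u)
  have hlevel := hu.1
  exact hlevel ▸ level_lt_of_mem_ancestors (by lia) hw

theorem measurableSet_blockSurvives_of_mem_descendants (j : ℕ) (hv : 1 ≤ v.level)
    (hu : u ∈ v.descendants m) :
    MeasurableSet[cylinderEvents {w | v.level + m ≤ w.level}]
      {ω : Config d | BlockSurvives ω m j u} := by
  have hlevel := hu.1
  refine cylinderEvents_mono (fun w hw => ?_) _ (measurableSet_blockSurvives m j (by lia))
  exact hlevel ▸ Vertex.level_le_of_mem_subtree hw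

theorem frogLaw_real_inter_of_level (h : Admissible d c q) {A B : Set (Config d)} {n : ℕ}
    (hA : MeasurableSet[cylinderEvents {w | w.level < n}] A)
    (hB : MeasurableSet[cylinderEvents {w | n ≤ w.level}] B) :
    (frogLaw h).real (A ∩ B) = (frogLaw h).real A * (frogLaw h).real B := by
  refine frogLaw_real_inter h ?_ hA hB
  rw [Set.disjoint_left]
  intro w hlt
  exact not_le_of_gt (Set.mem_ofPred.1 hlt)

theorem frogLaw_real_offspring (h : Admissible d c q) (j : ℕ) (hv : 1 ≤ v.level)
    (hu : u ∈ v.descendants m) :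
    (frogLaw h).real ({ω | Reach ω m u} ∩ {ω | BlockSurvives ω m j u}) =
      renewal (firstHitProb c q) m * (frogLaw h).real {ω | BlockSurvives ω m j u} := by
  have hlevel := hu.1
  rw [frogLaw_real_inter_of_level h (measurableSet_reach_of_mem_descendants hv hu)
    (measurableSet_blockSurvives_of_mem_descendants j hv hu),
    frogLaw_real_reach_of_lt h (by lia)]

theorem frogLaw_real_offspring_inter_le (h : Admissible d c q) (j : ℕ) (hv : 1 ≤ v.level)
    (hu : u ∈ v.descendants m) {u' : Vertex d} (hu' : u' ∈ v.descendants m) (hne : u ≠ u') :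
    (frogLaw h).real (({ω | Reach ω m u} ∩ {ω | BlockSurvives ω m j u}) ∩
      ({ω | Reach ω m u'} ∩ {ω | BlockSurvives ω m j u'})) ≤
        renewal (firstHitProb c q) m * ((frogLaw h).real {ω | BlockSurvives ω m j u} *
          (frogLaw h).real {ω | BlockSurvives ω m j u'}) := by
  have hlevel := hu.1
  have hlevel' := hu'.1
  rw [Set.inter_inter_inter_comm, frogLaw_real_inter_of_level h
      ((measurableSet_reach_of_mem_descendants hv hu).inter
        (measurableSet_reach_of_mem_descendants hv hu'))
      ((measurableSet_blockSurvives_of_mem_descendants j hv hu).inter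
        (measurableSet_blockSurvives_of_mem_descendants j hv hu')),
    frogLaw_real_inter h (Vertex.disjoint_subtree (hlevel.trans hlevel'.symm) hne)
      (measurableSet_blockSurvives m j (by lia)) (measurableSet_blockSurvives m j (by lia)),
    ← frogLaw_real_reach_of_lt h (show m < u.level by lia)]
  gcongr
  · exact measure_ne_top _ _
  · exact Set.inter_subset_left

theorem le_frogLaw_real_blockSurvives (h : Admissible d c q) {ε : ℝ} (hε : 0 < ε) (hε' : ε ≤ 1)
    (hM : ε * d ^ m * (d ^ m * renewal (firstHitProb c q) m) ≤
      d ^ m * renewal (firstHitProb c q) m - 1) (j : ℕ) (hv : 1 ≤ v.level) :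
    ε ≤ (frogLaw h).real {ω | BlockSurvives ω m j v} := by
  induction j generalizing v with
  | zero => simpa [BlockSurvives] using hε'
  | succ j ih =>
    have := (Vertex.finite_descendants hv m).fintype
    have hcard : (Fintype.card (v.descendants m) : ℝ) = d ^ m := by
      rw [← Nat.card_eq_fintype_card, Nat.card_coe_set_eq, Vertex.ncard_descendants hv]
      exact Nat.cast_pow _ _
    have hlevel : ∀ u : v.descendants m, 1 ≤ u.1.level := fun u => by
      rw [u.2.1]
      lia
    have hunion : {ω : Config d | BlockSurvives ω m (j + 1) v} = ⋃ u : v.descendants m,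
        {ω | Reach ω m u} ∩ {ω | BlockSurvives ω m j u} := by
      ext ω
      simp only [BlockSurvives, Set.mem_ofPred_eq, Set.mem_iUnion, Set.mem_inter_iff,
        Subtype.exists, exists_prop]
    rw [hunion]
    refine le_measureReal_iUnion_of_inter_le (fun u => ?_) hε
      (renewal_nonneg (firstHitProb_nonneg h.c_pos.le h.c_le_one h.q_pos.le h.q_le_one) m)
      (fun u => ih (hlevel u)) (fun u => frogLaw_real_offspring h j hv u.2)
      (fun u u' hne => frogLaw_real_offspring_inter_le h j hv u.2 u'.2 (Subtype.coe_ne_coe.2 hne))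
      (by rwa [hcard])
    exact (cylinderEvents_le_pi _ (measurableSet_reach m _)).inter
      (cylinderEvents_le_pi _ (measurableSet_blockSurvives m j (hlevel u)))

theorem le_frogLaw_real_forall_blockSurvives (h : Admissible d c q) {ε : ℝ} (hv : 1 ≤ v.level)
    (hε : ∀ j, ε ≤ (frogLaw h).real {ω | BlockSurvives ω m j v}) :
    ε ≤ (frogLaw h).real {ω | ∀ j, BlockSurvives ω m j v} := by
  have hanti : Antitone fun j => {ω : Config d | BlockSurvives ω m j v} :=
    antitone_nat_of_succ_le fun j ω => BlockSurvives.of_succ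
  have hmeas : ∀ j, MeasurableSet {ω : Config d | BlockSurvives ω m j v} := fun j =>
    cylinderEvents_le_pi _ (measurableSet_blockSurvives m j hv)
  have hlim := tendsto_measure_iInter_atTop (μ := frogLaw h) (fun j => (hmeas j).nullMeasurableSet)
    hanti ⟨0, measure_ne_top _ _⟩
  rw [Set.ofPred_forall]
  exact ge_of_tendsto' ((ENNReal.tendsto_toReal (measure_ne_top _ _)).comp hlim) hε

theorem survivalProb_pos_of_one_lt_renewal (h : Admissible d c q) (hm : 1 ≤ m)
    (hmean : 1 < d ^ m * renewal (firstHitProb c q) m) : 0 < survivalProb h := by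
  have hd : (0 : ℝ) < d := by have := h.two_le; positivity
  set μ := d ^ m * renewal (firstHitProb c q) m
  have hdm : (1 : ℝ) ≤ d ^ m := 
    one_le_pow₀ (by exact_mod_cast one_le_two.trans h.two_le)
  have hε : 0 < (μ - 1) / (d ^ m * μ) := div_pos (by linarith) (by positivity)
  have hε' : (μ - 1) / (d ^ m * μ) ≤ 1 := by
    rw [div_le_one (by positivity)]
    nlinarith
  have hM : (μ - 1) / (d ^ m * μ) * d ^ m * μ ≤ μ - 1 := by
    rw [mul_assoc, div_mul_cancel₀ _ (by positivity)]
  let v : Vertex d := .node 0 []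
  have hv : 1 ≤ v.level := le_rfl
  have hhit := measurableSet_hit v one_pos le_rfl
  have hsurv : MeasurableSet[cylinderEvents v.subtree] {ω | ∀ j, BlockSurvives ω m j v} := by
    rw [Set.ofPred_forall]
    exact .iInter fun j => measurableSet_blockSurvives m j hv
  have hdisj : Disjoint (ancestors v 0 1) v.subtree := Set.disjoint_left.2 fun w hw hw' =>
    (level_lt_of_mem_ancestors le_rfl hw).not_ge (Vertex.level_le_of_mem_subtree hw')
  calc 0 < (frogLaw h).real {ω | Hit ω 1 v} * ((μ - 1) / (d ^ m * μ)) :=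
        mul_pos (frogLaw_real_hit_one_pos h 0) hε
    _ ≤ (frogLaw h).real {ω | Hit ω 1 v} *
        (frogLaw h).real {ω | ∀ j, BlockSurvives ω m j v} := by
        gcongr
        exact le_frogLaw_real_forall_blockSurvives h hv fun j =>
          le_frogLaw_real_blockSurvives h hε hε' hM j hv
    _ = (frogLaw h).real ({ω | Hit ω 1 v} ∩ {ω | ∀ j, BlockSurvives ω m j v}) :=
        (frogLaw_real_inter h hdisj hhit hsurv).symm
    _ ≤ survivalProb h :=
        measureReal_mono fun ω hω => survives_of_forall_blockSurvives hm hω.1 hω.2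

end Branching

section FirstMoment

variable {c q : ℝ}

theorem Survives.exists_node_reach {ω : Config d} (hω : Survives ω) (n : ℕ) :
    ∃ i : Fin (d + 1), ∃ u ∈ (Vertex.node i []).descendants n, Reach ω (n + 1) u := by
  obtain ⟨w, hlevel, hreach⟩ := hω.exists_reach (n + 1)
  have hw : w ∈ (w.anc n).descendants n := Vertex.mem_descendants_anc (by lia)
  have hone : (w.anc n).level = 1 := by rw [Vertex.level_anc]; lia
  rcases hanc : w.anc n with _ | ⟨i, _ | ⟨j, l⟩⟩
  · simp [hanc, Vertex.level] at hone
  · exact ⟨i, w, hanc ▸ hw, hreach⟩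
  · simp [hanc, Vertex.level] at hone

theorem survivalProb_le (h : Admissible d c q) (n : ℕ) :
    survivalProb h ≤ (d + 1) * (d ^ n * renewal (firstHitProb c q) (n + 1)) := by
  have hfin : ∀ i : Fin (d + 1), ((Vertex.node i []).descendants n).Finite := fun i =>
    Vertex.finite_descendants le_rfl n
  have hcard : ∀ i, ((hfin i).toFinset.card : ℝ) = d ^ n := fun i => by
    rw [← Set.ncard_eq_toFinset_card _ (hfin i), Vertex.ncard_descendants le_rfl, Nat.cast_pow]
  have hcover : {ω : Config d | Survives ω} ⊆
      ⋃ i ∈ Finset.univ, ⋃ u ∈ (hfin i).toFinset, {ω | Reach ω (n + 1) u} := fun ω hω => by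
    obtain ⟨i, u, hu, hreach⟩ := Survives.exists_node_reach hω n
    simp only [Set.mem_iUnion]
    exact ⟨i, Finset.mem_univ i, u, (hfin i).mem_toFinset.2 hu, hreach⟩
  have hreach : ∀ i, ∀ u ∈ (hfin i).toFinset,
      (frogLaw h).real {ω | Reach ω (n + 1) u} ≤ renewal (firstHitProb c q) (n + 1) :=
    fun i u hu => frogLaw_real_reach_le h (by
      rw [((hfin i).mem_toFinset.1 hu).1, Vertex.level, List.length_nil]
      lia)
  calc survivalProb h
      ≤ ∑ i, ∑ u ∈ (hfin i).toFinset, (frogLaw h).real {ω | Reach ω (n + 1) u} :=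
        (measureReal_mono hcover (measure_ne_top _ _)).trans <|
          (measureReal_biUnion_finset_le _ _).trans <|
            Finset.sum_le_sum fun i _ => measureReal_biUnion_finset_le _ _
    _ ≤ ∑ i, ∑ u ∈ (hfin i).toFinset, renewal (firstHitProb c q) (n + 1) :=
        Finset.sum_le_sum fun i _ => Finset.sum_le_sum (hreach i)
    _ = (d + 1) * (d ^ n * renewal (firstHitProb c q) (n + 1)) := by
        simp [hcard]

end FirstMoment

section OffspringMean

variable {c q : ℝ}

/-- The sum, over the descendants of a vertex other than the root, of the probabilities that this
vertex is the closest ancestor whose particle visits the descendant. -/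
noncomputable def offspringMean (d : ℕ) (c q : ℝ) : ℝ :=
  ∑' k : ℕ, (d : ℝ) ^ (k + 1) * firstHitProb c q k

theorem missProb_le_one (hc : 0 ≤ c) (hc' : c ≤ 1) (hq : 0 ≤ q) (hq' : q ≤ 1) (k : ℕ) :
    missProb c q k ≤ 1 :=
  Finset.prod_le_one
    (fun _ _ => sub_nonneg.2 (mul_le_one₀ hc' (by positivity) (pow_le_one₀ hq hq')))
    fun _ _ => sub_le_self _ (by positivity)

theorem missProb_succ_le (hc : 0 ≤ c) (hc' : c ≤ 1) (hq : 0 ≤ q) (hq' : q ≤ 1) (k : ℕ) :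
    missProb c q (k + 1) ≤ 1 - c * q := by
  induction k with
  | zero => simp [missProb]
  | succ k ih =>
    have hmiss := missProb_nonneg hc' hq hq' (k + 1)
    rw [missProb, Finset.prod_range_succ, ← missProb]
    exact (mul_le_of_le_one_right hmiss (sub_le_self _ (by positivity))).trans ih

theorem le_missProb (hc : 0 ≤ c) (hc' : c ≤ 1) (hq : 0 ≤ q) (hq' : q < 1) (k : ℕ) :
    1 - c * q * (1 - q ^ k) / (1 - q) ≤ missProb c q k := by
  have hq1 : 0 < 1 - q := sub_pos.2 hq'
  induction k with
  | zero => simp [missProb]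
  | succ k ih =>
    have hgeom : c * q * (1 - q ^ (k + 1)) / (1 - q) =
        c * q * (1 - q ^ k) / (1 - q) + c * q ^ (k + 1) := by
      field_simp
      ring
    have hhit : 0 ≤ c * q ^ (k + 1) := by positivity
    rw [missProb, Finset.prod_range_succ, ← missProb, hgeom]
    nlinarith [missProb_le_one hc hc' hq hq'.le k]

theorem pow_mul_firstHitProb (d : ℕ) (c q : ℝ) (k : ℕ) :
    (d : ℝ) ^ (k + 1) * firstHitProb c q k = c * (d * q) ^ (k + 1) * missProb c q k := by
  rw [firstHitProb, mul_pow]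
  ring

theorem pow_mul_firstHitProb_nonneg (h : Admissible d c q) (k : ℕ) :
    0 ≤ (d : ℝ) ^ (k + 1) * firstHitProb c q k :=
  mul_nonneg (by positivity) (firstHitProb_nonneg h.c_pos.le h.c_le_one h.q_pos.le h.q_le_one k)

theorem summable_pow_mul_firstHitProb (h : Admissible d c q) :
    Summable fun k => (d : ℝ) ^ (k + 1) * firstHitProb c q k := by
  have hc := h.c_pos
  have hx := h.dq_pos
  refine .of_nonneg_of_le (pow_mul_firstHitProb_nonneg h) (fun k => ?_)
    (((summable_nat_add_iff 1).2 (summable_geometric_of_lt_one hx.le h.dq_lt_one)).mul_left c)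
  rw [pow_mul_firstHitProb]
  exact mul_le_of_le_one_right (by positivity)
    (missProb_le_one hc.le h.c_le_one h.q_pos.le h.q_le_one k)

theorem survivalProb_eq_zero (h : Admissible d c q) (hmean : offspringMean d c q < 1) :
    survivalProb h = 0 := by
  have hd : (d : ℝ) ≠ 0 := by have := h.two_le; positivity
  have hlim := (summable_renewal (pow_mul_firstHitProb_nonneg h)
    (summable_pow_mul_firstHitProb h) hmean).tendsto_atTop_zero
  have hlim' := ((Filter.tendsto_add_atTop_iff_nat 1).2 hlim).const_mul ((d + 1) / d : ℝ)
  rw [mul_zero] at hlim'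
  refine le_antisymm (ge_of_tendsto' hlim' fun n => (survivalProb_le h n).trans_eq ?_)
    measureReal_nonneg
  rw [renewal_pow_mul, pow_succ]
  field_simp

theorem survivalProb_pos (h : Admissible d c q) (hmean : 1 < offspringMean d c q) :
    0 < survivalProb h := by
  obtain ⟨K, hK⟩ := ((summable_pow_mul_firstHitProb h).hasSum.tendsto_sum_nat.eventually_const_lt
    hmean).exists
  obtain ⟨m, hm, hmean_m⟩ := exists_one_lt_renewal (pow_mul_firstHitProb_nonneg h) hK
  rw [renewal_pow_mul] at hmean_m
  exact survivalProb_pos_of_one_lt_renewal h hm hmean_m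

theorem offspringMean_le (h : Admissible d c q) :
    offspringMean d c q ≤ c * (d * q) + c * (d * q) ^ 2 * (1 - c * q) * (1 - d * q)⁻¹ := by
  have hc := h.c_pos
  have hx := h.dq_pos
  have hgeom := (hasSum_geometric_of_lt_one hx.le h.dq_lt_one).mul_left
    (c * (d * q) ^ 2 * (1 - c * q))
  have hsum := summable_pow_mul_firstHitProb h
  rw [offspringMean, hsum.tsum_eq_zero_add, ← hgeom.tsum_eq]
  refine add_le_add (by simp [firstHitProb, missProb, mul_left_comm])
    (((summable_nat_add_iff 1).2 hsum).tsum_le_tsum (fun k => ?_) hgeom.summable)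
  calc (d : ℝ) ^ (k + 1 + 1) * firstHitProb c q (k + 1)
      = c * (d * q) ^ (k + 1 + 1) * missProb c q (k + 1) := pow_mul_firstHitProb d c q (k + 1)
    _ ≤ c * (d * q) ^ (k + 1 + 1) * (1 - c * q) := by
        gcongr
        exact missProb_succ_le hc.le h.c_le_one h.q_pos.le h.q_le_one k
    _ = c * (d * q) ^ 2 * (1 - c * q) * (d * q) ^ k := by ring

theorem le_offspringMean (h : Admissible d c q) :
    c * (d * q) * (1 - c * q / (1 - q)) * (1 - d * q)⁻¹ +
      c ^ 2 * (d * q) * q / (1 - q) * (1 - d * q * q)⁻¹ ≤ offspringMean d c q := by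
  have hc := h.c_pos
  have hq := h.q_pos
  have hq1 : q < 1 := h.q_le_half.trans_lt one_half_lt_one
  have hx := h.dq_pos
  have hxq : d * q * q < 1 := by nlinarith [h.dq_lt_one]
  have hgeom := ((hasSum_geometric_of_lt_one hx.le h.dq_lt_one).mul_left
    (c * (d * q) * (1 - c * q / (1 - q)))).add
      ((hasSum_geometric_of_lt_one (by positivity : 0 ≤ d * q * q) hxq).mul_left
        (c ^ 2 * (d * q) * q / (1 - q)))
  rw [offspringMean, ← hgeom.tsum_eq]
  refine hgeom.summable.tsum_le_tsum (fun k => ?_) (summable_pow_mul_firstHitProb h)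
  calc c * (d * q) * (1 - c * q / (1 - q)) * (d * q) ^ k +
        c ^ 2 * (d * q) * q / (1 - q) * (d * q * q) ^ k
      = c * (d * q) ^ (k + 1) * (1 - c * q * (1 - q ^ k) / (1 - q)) := by ring
    _ ≤ c * (d * q) ^ (k + 1) * missProb c q k := by
        gcongr
        exact le_missProb hc.le h.c_le_one hq.le hq1 k
    _ = (d : ℝ) ^ (k + 1) * firstHitProb c q k := (pow_mul_firstHitProb d c q k).symm

theorem offspringMean_lt_one (h : Admissible d c q)
    (hlt : d * q * (c + 1) - c ^ 2 * q * (d * q) ^ 2 < 1) : offspringMean d c q < 1 := by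
  have hx : 0 < 1 - d * q := sub_pos.2 h.dq_lt_one
  have hbound : c * (d * q) + c * (d * q) ^ 2 * (1 - c * q) * (1 - d * q)⁻¹ =
      1 - (1 - (d * q * (c + 1) - c ^ 2 * q * (d * q) ^ 2)) / (1 - d * q) := by
    field_simp
    ring
  exact (offspringMean_le h).trans_lt (hbound.trans_lt (sub_lt_self _ (div_pos (by linarith) hx)))

theorem one_lt_offspringMean (h : Admissible d c q)
    (hlt : c ^ 2 * q * (d * q) ^ 2 < (d * q * (c + 1) - 1) * (1 - d * q * q)) :
    1 < offspringMean d c q := by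
  have hx : 0 < 1 - d * q := sub_pos.2 h.dq_lt_one
  have hq : 0 < 1 - q := by linarith [h.q_le_half]
  have hxq : 0 < 1 - d * q * q := by nlinarith [h.dq_lt_one, h.dq_pos]
  have hle := le_offspringMean h
  generalize (d : ℝ) * q = x at hlt hx hxq hle
  have hbound : c * x * (1 - c * q / (1 - q)) * (1 - x)⁻¹ +
      c ^ 2 * x * q / (1 - q) * (1 - x * q)⁻¹ =
        1 + ((x * (c + 1) - 1) * (1 - x * q) - c ^ 2 * q * x ^ 2) / ((1 - x) * (1 - x * q)) := by
    field_simp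
    ring
  exact (lt_add_of_pos_right 1 (div_pos (sub_pos.2 hlt) (by positivity))).trans_le
    (hbound.symm.trans_le hle)

end OffspringMean

section CriticalParameter

variable {c q : ℝ}

theorem exists_survivalProb_pos (hd : 2 ≤ d) (hc : 0 < c) (hc' : c ≤ 1) :
    ∃ (q : ℝ) (h : Admissible d c q), 0 < survivalProb h := by
  have hd' : (2 : ℝ) ≤ d := by exact_mod_cast hd
  -- Any `x = d q` close enough to one would do; how close depends on `c` only.
  obtain ⟨x, hx⟩ : ∃ x : ℝ, x = 1 - c / 5 := ⟨_, rfl⟩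
  have hx0 : 0 < x := by linarith
  have hdq : (d : ℝ) * (x / d) = x := by field_simp
  have h : Admissible d c (x / d) := ⟨hd, hc, hc', by positivity, by linarith⟩
  refine ⟨x / d, h, survivalProb_pos h (one_lt_offspringMean h ?_)⟩
  have hq : x / d ≤ x / 2 := by gcongr
  have hpoly : c * (x / 2) * x ^ 2 < (4 - c) / 5 * (1 - x * (x / 2)) := by
    subst hx
    nlinarith [mul_nonneg hc.le (sub_nonneg.2 hc'), mul_pos hc hc,
      mul_nonneg (mul_pos hc hc).le (sub_nonneg.2 hc')]
  calc c ^ 2 * (x / d) * (d * (x / d)) ^ 2 = c * (c * (x / d) * x ^ 2) := by rw [hdq]; ring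
    _ ≤ c * (c * (x / 2) * x ^ 2) := by gcongr
    _ < c * ((4 - c) / 5 * (1 - x * (x / 2))) := by gcongr
    _ ≤ c * ((4 - c) / 5 * (1 - x * (x / d))) := by
        have : 0 ≤ 4 - c := by linarith
        gcongr
    _ = (d * (x / d) * (c + 1) - 1) * (1 - d * (x / d) * (x / d)) := by rw [hdq, hx]; ring

theorem le_criticalQ (hd : 2 ≤ d) (hc : 0 < c) (hc' : c ≤ 1) {b : ℝ}
    (hb : ∀ q < b, ∀ h : Admissible d c q, survivalProb h = 0) : b ≤ criticalQ d c := by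
  refine le_csInf (exists_survivalProb_pos hd hc hc') ?_
  rintro q ⟨h, hpos⟩
  by_contra! hq
  exact hpos.ne' (hb q hq h)

theorem criticalQ_le (h : Admissible d c q) (hpos : 0 < survivalProb h) : criticalQ d c ≤ q :=
  csInf_le ⟨0, fun _ ⟨h', _⟩ => h'.q_pos.le⟩ ⟨h, hpos⟩

end CriticalParameter

section Bounds

variable {c q : ℝ}

theorem offspringMean_lt_one_of_lt (h : Admissible d c q)
    (hq : q < 1 / (d * (c + 1) - (c / (c + 1)) ^ 2)) : offspringMean d c q < 1 := by
  refine offspringMean_lt_one h ?_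
  have hd : (2 : ℝ) ≤ d := by exact_mod_cast h.two_le
  have hc := h.c_pos
  have hq0 := h.q_pos
  set s : ℝ := c / (c + 1) with hs
  have hs0 : 0 < s := by positivity
  have hs1 : s < 1 := by rw [hs, div_lt_one (by positivity)]; linarith
  rw [lt_div_iff₀ (by nlinarith)] at hq
  rcases lt_or_ge (d * q * (c + 1)) 1 with hlt | hge
  · linarith [show 0 ≤ c ^ 2 * q * (d * q) ^ 2 by positivity]
  · have hsx : s ≤ c * (d * q) := by
      rw [hs, div_le_iff₀ (by positivity)]
      nlinarith
    have hsx2 : s ^ 2 ≤ (c * (d * q)) ^ 2 := by gcongr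
    nlinarith

theorem smaller_root_mem_Ioo_of_neg {a b e t x : ℝ} (ha : 0 < a) (he : 0 < e) (ht : 0 < t)
    (hneg : a * t ^ 2 - b * t + e < 0) (hx : x = (b - √(b ^ 2 - 4 * a * e)) / (2 * a)) :
    a * x ^ 2 - b * x + e = 0 ∧ x ∈ Set.Ioo 0 t := by
  have hb : 0 < b := by
    by_contra! hb
    nlinarith [mul_pos ha (pow_pos ht 2)]
  have hlt : (b - 2 * a * t) ^ 2 < b ^ 2 - 4 * a * e := by nlinarith
  have hdisc : discrim a (-b) e = √(b ^ 2 - 4 * a * e) * √(b ^ 2 - 4 * a * e) := by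
    rw [Real.mul_self_sqrt ((sq_nonneg _).trans hlt.le), discrim, neg_sq]
  have hroot := (quadratic_eq_zero_iff ha.ne' hdisc x).2 (.inr (by rw [hx, neg_neg]))
  refine ⟨by linarith, ?_, ?_⟩
  · rw [hx]
    refine div_pos (sub_pos.2 ((Real.sqrt_lt' hb).2 ?_)) (by positivity)
    linarith [mul_pos (mul_pos four_pos ha) he]
  · rw [hx, div_lt_iff₀ (by positivity)]
    linarith [Real.lt_sqrt_of_sq_lt hlt]

theorem seven_mul_sq_lt_of_le {s q : ℝ} (hs : 0 ≤ s) (hs' : s ≤ 1 / 2) (hq : 0 ≤ q)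
    (hq' : q ≤ (1 - 7 / 10 * s) / 3) :
    7 * (1 + 16 / 21 * s * q) ^ 2 < 8 * (1 + q) * (1 - (1 - 7 / 10 * s) * q) := by
  set X : ℝ := 1 - 7 / 10 * s with hX
  set B : ℝ := 8 - 8 * X - 32 / 3 * s - (8 * X + 7 * (16 / 21 * s) ^ 2) * (X / 3) with hB
  -- The difference of the two sides is concave in `q`, hence above its chord on `[0, X / 3]`.
  have hchord : 1 + q * B ≤
      8 * (1 + q) * (1 - X * q) - 7 * (1 + 16 / 21 * s * q) ^ 2 := by
    have : 0 ≤ (8 * X + 7 * (16 / 21 * s) ^ 2) * (q * (X / 3 - q)) :=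
      mul_nonneg (by nlinarith) (mul_nonneg hq (sub_nonneg.2 hq'))
    nlinarith
  have hend : 0 < 1 + X / 3 * B := by
    have hs'' : 0 ≤ 1 / 2 - s := sub_nonneg.2 hs'
    rw [hB, hX]
    nlinarith [mul_nonneg hs hs'', mul_nonneg (sq_nonneg s) hs'',
      mul_nonneg hs (sq_nonneg (1 / 2 - s)),
      mul_nonneg (mul_nonneg hs hs'') (mul_nonneg hs hs''), sq_nonneg (s - 1 / 4)]
  rcases le_or_gt 0 B with hB0 | hB0
  · linarith [mul_nonneg hq hB0]
  · nlinarith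

theorem seven_mul_sq_lt_of_eq {s q y : ℝ} (hs : 0 < s) (hs' : s ≤ 1 / 2) (hq : 0 < q)
    (hq' : q ≤ 1 / 3) (hy : y = 1 + 8 / 7 * s ^ 2 * q * (1 + q)) (hqy : q ≤ (1 - s) * y / 3) :
    7 * y ^ 2 < 8 * (1 + q) * (1 - (1 - s) * y * q) := by
  have hsq : s * q * (s * (1 + q)) ≤ s * q * (2 / 3) := by gcongr; nlinarith
  have hqq : s ^ 2 * (q * (1 + q)) ≤ s ^ 2 * (4 / 9) := by gcongr; nlinarith
  have hy0 : 0 ≤ y := by rw [hy]; positivity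
  have hyq : y ≤ 1 + 16 / 21 * s * q := by linarith
  have hys : (1 - s) * y ≤ 1 - 7 / 10 * s := by
    have hle : y ≤ 1 + 32 / 63 * s ^ 2 := by linarith
    nlinarith [mul_le_mul_of_nonneg_left hle (show 0 ≤ 1 - s by linarith), pow_pos hs 3]
  calc 7 * y ^ 2 ≤ 7 * (1 + 16 / 21 * s * q) ^ 2 := by gcongr
    _ < 8 * (1 + q) * (1 - (1 - 7 / 10 * s) * q) :=
        seven_mul_sq_lt_of_le hs.le hs' hq.le (by linarith)
    _ ≤ 8 * (1 + q) * (1 - (1 - s) * y * q) := by gcongr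

theorem one_lt_offspringMean_of_root (h : Admissible d c q) (hd : 3 ≤ d)
    (hroot : 8 * c ^ 2 * q ^ 2 - F c d * q + 7 * (c + 1) ^ 2 = 0) : 1 < offspringMean d c q := by
  have hd' : (3 : ℝ) ≤ d := by exact_mod_cast hd
  have hc := h.c_pos
  have hq := h.q_pos
  have hqx : 3 * q ≤ d * q := by gcongr
  obtain ⟨s, hcs⟩ : ∃ s : ℝ, s * (c + 1) = c := ⟨c / (c + 1), by field_simp⟩
  obtain ⟨y, hy⟩ : ∃ y : ℝ, y = d * q * (c + 1) := ⟨_, rfl⟩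
  have hcs2 : c ^ 2 = (s * (c + 1)) ^ 2 := by rw [hcs]
  have hs : 0 < s := pos_of_mul_pos_left (hcs.symm ▸ hc) (by positivity)
  have hs' : s ≤ 1 / 2 := by nlinarith [h.c_le_one]
  have hx : d * q = (1 - s) * y := by rw [hy]; linear_combination d * q * hcs
  have hy' : y = 1 + 8 / 7 * s ^ 2 * q * (1 + q) := by
    refine mul_left_cancel₀ (a := 7 * (c + 1) ^ 2) (by positivity) ?_
    rw [F] at hroot
    rw [hy]
    linear_combination -hroot + 8 * (q + q ^ 2) * hcs2
  have hbound := seven_mul_sq_lt_of_eq hs hs' hq (by linarith [h.dq_lt_one]) hy' (by linarith)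
  refine one_lt_offspringMean h ?_
  calc c ^ 2 * q * (d * q) ^ 2 = s ^ 2 * q / 7 * (7 * y ^ 2) := by rw [hcs2, hy]; ring
    _ < s ^ 2 * q / 7 * (8 * (1 + q) * (1 - (1 - s) * y * q)) := by gcongr
    _ = (d * q * (c + 1) - 1) * (1 - d * q * q) := by
        rw [← hy, hx]
        linear_combination -(1 - (1 - s) * y * q) * hy'

theorem F_smaller_root_mem_Ioo (hd : 3 ≤ d) (hc : 0 < c) (hq : q =
      (F c d - √(F c d ^ 2 - 224 * c ^ 2 * (c + 1) ^ 2)) / (16 * c ^ 2)) :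
    8 * c ^ 2 * q ^ 2 - F c d * q + 7 * (c + 1) ^ 2 = 0 ∧ q ∈ Set.Ioo 0 (1 / (d : ℝ)) := by
  have hd' : (3 : ℝ) ≤ d := by exact_mod_cast hd
  have hneg : 8 * c ^ 2 * (1 / d) ^ 2 - F c d * (1 / d) + 7 * (c + 1) ^ 2 < 0 := by
    have hfactor : 8 * c ^ 2 * (1 / d) ^ 2 - F c d * (1 / d) + 7 * (c + 1) ^ 2 =
        -(c * (7 * d ^ 2 * (c + 1) ^ 2 - 8 * c * (1 + d)) / d ^ 2) := by
      rw [F]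
      field_simp
      ring
    have hamgm : 7 * (d : ℝ) ^ 2 * (4 * c) ≤ 7 * d ^ 2 * (c + 1) ^ 2 := by
      gcongr
      linarith [sq_nonneg (c - 1)]
    have hpos : 0 < 7 * (d : ℝ) ^ 2 * (c + 1) ^ 2 - 8 * c * (1 + d) := by
      nlinarith [show 0 < c * (28 * (d : ℝ) ^ 2 - 8 * (1 + d)) from mul_pos hc (by nlinarith)]
    rw [hfactor, neg_lt_zero]
    positivity
  exact smaller_root_mem_Ioo_of_neg (by positivity) (by positivity) (by positivity) hneg
    (by rw [hq]; ring_nf)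

end Bounds

end FrogTree

theorem corollary2 (d : ℕ) (c : ℝ) (hc0 : 0 < c) (hc1 : c ≤ 1) :
    (2 ≤ d → 1 / (d * (c + 1) - (c / (c + 1)) ^ 2) ≤ FrogTree.criticalQ d c) ∧
    (3 ≤ d → FrogTree.criticalQ d c ≤
      (FrogTree.F c d - √(FrogTree.F c d ^ 2 - 224 * c ^ 2 * (c + 1) ^ 2)) / (16 * c ^ 2)) := by
  refine ⟨fun hd => ?_, fun hd => ?_⟩
  · refine FrogTree.le_criticalQ hd hc0 hc1 fun q hq h => ?_
    exact FrogTree.survivalProb_eq_zero h (FrogTree.offspringMean_lt_one_of_lt h hq)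
  · obtain ⟨hroot, hq_pos, hq_lt⟩ := FrogTree.F_smaller_root_mem_Ioo hd hc0 rfl
    have hdq := (lt_div_iff₀' (by positivity)).1 hq_lt
    have h : FrogTree.Admissible d c _ := ⟨by lia, hc0, hc1, hq_pos, hdq⟩
    exact FrogTree.criticalQ_le h
      (FrogTree.survivalProb_pos h (FrogTree.one_lt_offspringMean_of_root h hd hroot))
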